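/- Let $\mathbf{Top}$ be the category of all topological spaces and continuous maps. *The valuation monad.* For a space $X$ with lattice of open sets $\mathcal O(X)$, a continuous valuation on $X$ is a map $\nu:\mathcal O(X)\to[0,\infty]$ with $\nu(\emptyset)=0$ that is monotone, modular ($\nu(U\cup W)+\nu(U\cap W)=\nu(U)+\nu(W)$) and Scott continuous ($\nu(\bigcup_\lambda U_\lambda)=\sup_\lambda\nu(U_\lambda)$ for directed families). $VX$ is the set of continuous valuations on $X$, with the topology generated by the sets $\{\nu:\nu(U)>r\}$ for $U$ open and $r\in[0,\infty)$. For lower semicontinuous $g:X\to[0,\infty]$, $\int g\,d\nu$ is the supremum of $\sum_{i} r_i\,\nu(U_i)$ over all finite sums $\sum_{i} r_i 1_{U_i}\le g$ with $U_i$ open and $r_i\in[0,\infty]$. For continuous $f:X\to Y$ let $f_*\nu(U)=\nu(f^{-1}(U))$; let $\delta_x(U)=1$ if $x\in U$ and $0$ otherwise; and for $\xi\in VVX$ let $(\mathcal E\xi)(U)=\int_{VX}\nu(U)\,d\xi(\nu)$ (equivalently, $\int g\,d(\mathcal E\xi)=\int(\int g\,d\nu)\,d\xi(\nu)$ for all lower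 semicontinuous $g$). These data form a monad $(V,\delta,\mathcal E)$ on $\mathbf{Top}$. *The hyperspace monad.* $HX$ is the set of all closed subsets of $X$ (including $\emptyset$), with the topology generated by the sets $\mathrm{Hit}(U)=\{C: C\cap U\neq\emptyset\}$ for $U$ open. For continuous $f:X\to Y$ let $f_\sharp(C)=\mathrm{cl}(f(C))$; let $\sigma(x)=\mathrm{cl}\{x\}$; and for $\mathcal C\in HHX$ let $\mathcal U(\mathcal C)=\mathrm{cl}\bigl(\bigcup_{C\in\mathcal C}C\bigr)$. These data form a monad $(H,\sigma,\mathcal U)$ on $\mathbf{Top}$. *The support.* For $\nu\in VX$ let $\mathrm{supp}(\nu)$ be the complement of the union of all open sets $U$ with $\nu(U)=0$. **Theorem.** 1. For every space $X$ and $\nu\in VX$, $\mathrm{supp}(\nu)$ is the unique closed set $C\subseteq X$ such that for every open $U$: $C\cap U\ne\emptyset$ if and only if $\nu(U)>0$. 2. For every space $X$, the map $\mathrm{supp}:VX\to HX$ is continuous. 3. For every continuous $f:X\to Y$ and $\nu\in VX$, $\mathrm{supp}(f_*\nu)=f_\sharp(\mathrm{supp}(\nu))$. 4. For every space $X$ and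 $x\in X$, $\mathrm{supp}(\delta_x)=\sigma(x)=\mathrm{cl}\{x\}$. 5. For every space $X$ and $\xi\in VVX$, $\mathrm{supp}(\mathcal E\xi)=\mathcal U\bigl(\mathrm{supp}_\sharp(\mathrm{supp}(\xi))\bigr)=\mathrm{cl}\Bigl(\bigcup_{\nu\in\mathrm{supp}(\xi)}\mathrm{supp}(\nu)\Bigr)$. 6. Consequently the maps $\mathrm{supp}:VX\to HX$ are the components of a morphism of monads $(V,\delta,\mathcal E)\to(H,\sigma,\mathcal U)$, that is, a natural transformation compatible with the units and the multiplications. -/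

import Mathlib

open CategoryTheory TopologicalSpace
open scoped ENNReal NNReal

universe u

/-- A continuous valuation on a topological space: a strict, monotone, modular and Scott-continuous
map from the lattice of open sets to `[0, ∞]`. -/
@[ext]
structure ContinuousValuation (X : Type u) [TopologicalSpace X] where
  toFun : Opens X → ℝ≥0∞
  map_bot' : toFun ⊥ = 0
  mono' : ∀ U V : Opens X, U ≤ V → toFun U ≤ toFun V
  modular' : ∀ U V : Opens X, toFun (U ⊔ V) + toFun (U ⊓ V) = toFun U + toFun V
  scott' : ∀ D : Set (Opens X), D.Nonempty → DirectedOn (· ≤ ·) D →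
    toFun (sSup D) = ⨆ U ∈ D, toFun U

namespace ContinuousValuation

variable {X Y : Type u} [TopologicalSpace X] [TopologicalSpace Y]

instance : CoeFun (ContinuousValuation X) (fun _ => Opens X → ℝ≥0∞) := ⟨toFun⟩

/-- The topology on `VX` generated by the sets `θ(U, r) = {ν | ν(U) > r}`, for `U` open and
`r ∈ [0, ∞)`. -/
instance : TopologicalSpace (ContinuousValuation X) :=
  generateFrom {S | ∃ (U : Opens X) (r : ℝ≥0), S = {ν : ContinuousValuation X | (r : ℝ≥0∞) < ν U}}

/-- The lower integral `∫ g dν` of a lower semicontinuous function `g : X → [0, ∞]`: the supremum of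
`∑ i, r i * ν (U i)` over all simple functions `∑ i, r i * 1_{U i}` (with `U i` open) below `g`. -/
noncomputable def integral (ν : ContinuousValuation X) (g : X → ℝ≥0∞) : ℝ≥0∞ :=
  ⨆ (n : ℕ) (r : Fin n → ℝ≥0∞) (U : Fin n → Opens X)
    (_ : ∀ x, ∑ i, r i * (U i : Set X).indicator 1 x ≤ g x), ∑ i, r i * ν (U i)

/-! ### Scalar staircase approximation -/

/-- The number of the first `4 ^ n` positive multiples of `2 ^ (-n)` strictly below `t`. -/
noncomputable def stairNum (n : ℕ) (t : ℝ≥0∞) : ℕ :=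
  ∑ k ∈ Finset.range (4 ^ n), (Set.Iio t).indicator (fun _ => 1) (((k : ℝ≥0∞) + 1) * 2⁻¹ ^ n)

/-- `stairNum n t` rescaled by `2 ^ (-n)`. -/
noncomputable def stair (n : ℕ) (t : ℝ≥0∞) : ℝ≥0∞ := 2⁻¹ ^ n * (stairNum n t : ℝ≥0∞)

lemma two_inv_pow_ne_top (n : ℕ) : (2⁻¹ ^ n : ℝ≥0∞) ≠ ∞ :=
  ENNReal.pow_ne_top (ENNReal.inv_ne_top.2 two_ne_zero)

lemma two_inv_pow_ne_zero (n : ℕ) : (2⁻¹ ^ n : ℝ≥0∞) ≠ 0 :=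
  pow_ne_zero _ (ENNReal.inv_ne_zero.2 ENNReal.ofNat_ne_top)

lemma two_inv_pow_mul (n : ℕ) : (2⁻¹ ^ n : ℝ≥0∞) * 2 ^ n = 1 := by
  rw [← mul_pow, ENNReal.inv_mul_cancel two_ne_zero ENNReal.ofNat_ne_top, one_pow]

/-- Counting multiples of `e` strictly below `t`: the count is `0`, or the count times `e` is
below `t`. -/
lemma count_lt (e t : ℝ≥0∞) (K : ℕ) :
    (∑ k ∈ Finset.range K, (Set.Iio t).indicator (fun _ => (1 : ℕ)) (((k : ℝ≥0∞) + 1) * e)) = 0 ∨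
    ((∑ k ∈ Finset.range K,
      (Set.Iio t).indicator (fun _ => (1 : ℕ)) (((k : ℝ≥0∞) + 1) * e) : ℕ) : ℝ≥0∞) * e < t := by
  classical
  induction K with
  | zero => simp
  | succ K ih =>
    rw [Finset.sum_range_succ]
    by_cases h : ((K : ℝ≥0∞) + 1) * e < t
    · right
      refine lt_of_le_of_lt ?_ h
      gcongr
      have h1 : ∀ k ∈ Finset.range K,
          (Set.Iio t).indicator (fun _ => (1 : ℕ)) (((k : ℝ≥0∞) + 1) * e) ≤ 1 := by
        intro k _
        unfold Set.indicator
        split_ifs <;> simp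
      have h2 := Finset.sum_le_sum h1
      have h3 : (Set.Iio t).indicator (fun _ => (1 : ℕ)) (((K : ℝ≥0∞) + 1) * e) = 1 := by
        simp [h]
      rw [h3]
      simp only [Finset.sum_const, Finset.card_range, smul_eq_mul, mul_one] at h2
      exact_mod_cast Nat.add_le_add_right h2 1
    · have h3 : (Set.Iio t).indicator (fun _ => (1 : ℕ)) (((K : ℝ≥0∞) + 1) * e) = 0 := by
        simp only [Set.indicator_apply_eq_zero, Set.mem_Iio]
        exact fun h' => absurd h' h
      rw [h3, add_zero]
      exact ih

lemma stair_lt (n : ℕ) (t : ℝ≥0∞) : stair n t = 0 ∨ stair n t < t := by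
  rcases count_lt (2⁻¹ ^ n) t (4 ^ n) with h | h
  · left; simp [stair, stairNum, h]
  · right; rw [stair, mul_comm]; exact h

lemma stair_le (n : ℕ) (t : ℝ≥0∞) : stair n t ≤ t := by
  rcases stair_lt n t with h | h
  · simp [h]
  · exact h.le

lemma sum_range_two_mul (f : ℕ → ℕ) (N : ℕ) :
    ∑ k ∈ Finset.range (2 * N), f k = ∑ k ∈ Finset.range N, (f (2 * k) + f (2 * k + 1)) := by
  induction N with
  | zero => simp
  | succ N ih =>
    rw [show 2 * (N + 1) = 2 * N + 1 + 1 by ring, Finset.sum_range_succ, Finset.sum_range_succ, ih,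
      Finset.sum_range_succ]
    ring

lemma stair_mono (t : ℝ≥0∞) : Monotone (fun n => stair n t) := by
  classical
  refine monotone_nat_of_le_succ fun n => ?_
  have key : 2 * stairNum n t ≤ stairNum (n + 1) t := by
    unfold stairNum
    have h4 : 2 * 4 ^ n ≤ 4 ^ (n + 1) := by rw [pow_succ]; omega
    refine le_trans ?_ (Finset.sum_le_sum_of_subset (Finset.range_mono h4))
    rw [sum_range_two_mul, Finset.mul_sum]
    refine Finset.sum_le_sum fun k _ => ?_
    by_cases h : ((k : ℝ≥0∞) + 1) * 2⁻¹ ^ n < t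
    · have e2 : (((2 * k + 1 : ℕ) : ℝ≥0∞) + 1) * 2⁻¹ ^ (n + 1) = ((k : ℝ≥0∞) + 1) * 2⁻¹ ^ n := by
        push_cast
        rw [pow_succ, show (2 * (k : ℝ≥0∞) + 1 + 1) = (k + 1) * 2 by ring,
          show ((k : ℝ≥0∞) + 1) * 2 * (2⁻¹ ^ n * 2⁻¹) = (k + 1) * 2⁻¹ ^ n * (2⁻¹ * 2) by ring,
          ENNReal.inv_mul_cancel two_ne_zero ENNReal.ofNat_ne_top, mul_one]
      have e1 : (((2 * k : ℕ) : ℝ≥0∞) + 1) * 2⁻¹ ^ (n + 1) < t := by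
        refine lt_of_le_of_lt ?_ h
        rw [← e2]
        gcongr
        exact Nat.le_succ _
      rw [← e2] at h
      rw [← e2, Set.indicator_of_mem (Set.mem_Iio.2 h), Set.indicator_of_mem (Set.mem_Iio.2 e1)]
      norm_num
    · rw [Set.indicator_of_notMem (by simpa using h)]
      simp
  show stair n t ≤ stair (n + 1) t
  unfold stair
  calc (2⁻¹ ^ n : ℝ≥0∞) * (stairNum n t : ℝ≥0∞)
      = 2⁻¹ ^ (n + 1) * ((2 * stairNum n t : ℕ) : ℝ≥0∞) := by
        push_cast
        rw [pow_succ, show (2⁻¹ ^ n * 2⁻¹ : ℝ≥0∞) * (2 * (stairNum n t : ℝ≥0∞)) =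
          2⁻¹ ^ n * (stairNum n t : ℝ≥0∞) * (2⁻¹ * 2) by ring,
          ENNReal.inv_mul_cancel two_ne_zero ENNReal.ofNat_ne_top, mul_one]
    _ ≤ _ := by gcongr

lemma iSup_stair (t : ℝ≥0∞) : ⨆ n, stair n t = t := by
  classical
  refine le_antisymm (iSup_le fun n => stair_le n t) ?_
  refine le_of_forall_lt fun y hy => ?_
  lift y to ℝ≥0 using hy.ne_top with z
  obtain ⟨n₁, hn₁⟩ := ENNReal.exists_inv_two_pow_lt (tsub_pos_of_lt hy).ne'
  obtain ⟨n₂, hn₂⟩ := exists_nat_gt z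
  set n := max n₁ (n₂ + 1) with hn
  set j : ℕ := ⌊z * 2 ^ n⌋₊ + 1 with hj
  have hz1 : z < (j : ℝ≥0) / 2 ^ n := by
    rw [lt_div_iff₀ (by positivity)]
    rw [hj]; push_cast; exact Nat.lt_floor_add_one _
  have hz2 : (j : ℝ≥0) / 2 ^ n ≤ z + (2⁻¹) ^ n := by
    rw [div_le_iff₀ (by positivity), add_mul, ← mul_pow, inv_mul_cancel₀ two_ne_zero, one_pow, hj]
    push_cast
    gcongr
    exact Nat.floor_le (by positivity)
  have hj4 : j ≤ 4 ^ n := by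
    have h1 : z < 2 ^ n - 1 + 0 ∨ z + 1 ≤ 2 ^ n := by
      right
      have : n₂ + 1 ≤ 2 ^ n :=
        (le_max_right n₁ (n₂ + 1)).trans (Nat.lt_two_pow_self).le
      calc z + 1 ≤ (n₂ : ℝ≥0) + 1 := by gcongr
        _ ≤ 2 ^ n := by exact_mod_cast this
    have h2 : z + 1 ≤ 2 ^ n := by
      rcases h1 with h1 | h1
      · rw [add_zero] at h1
        exact (lt_tsub_iff_right.1 h1).le
      · exact h1
    have h3 : (j : ℝ≥0) ≤ 4 ^ n := by
      calc (j : ℝ≥0) ≤ (z + (2⁻¹) ^ n) * 2 ^ n := by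
            rwa [div_le_iff₀ (by positivity)] at hz2
        _ ≤ (z + 1) * 2 ^ n := by
            gcongr
            exact pow_le_one₀ (by positivity) (by
              rw [inv_le_one₀ (by norm_num)]; norm_num)
        _ ≤ 2 ^ n * 2 ^ n := by gcongr
        _ = 4 ^ n := by rw [← mul_pow]; norm_num
    exact_mod_cast h3
  have e3 : ((j : ℝ≥0∞)) * 2⁻¹ ^ n = (((j : ℝ≥0) / 2 ^ n : ℝ≥0) : ℝ≥0∞) := by
    rw [div_eq_mul_inv, ENNReal.coe_mul, ENNReal.coe_inv (by positivity)]
    push_cast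
    rw [ENNReal.inv_pow]
  have hjt : ((j : ℝ≥0∞)) * 2⁻¹ ^ n < t := by
    rw [e3]
    calc (((j : ℝ≥0) / 2 ^ n : ℝ≥0) : ℝ≥0∞) ≤ ((z + (2⁻¹) ^ n : ℝ≥0) : ℝ≥0∞) := by
          exact_mod_cast hz2
      _ = z + 2⁻¹ ^ n := by push_cast; rfl
      _ ≤ z + 2⁻¹ ^ n₁ := by
          gcongr _ + ?_
          exact pow_le_pow_right_of_le_one' (ENNReal.inv_le_one.2 one_le_two) (le_max_left _ _)
      _ < z + (t - z) := by
          exact ENNReal.add_lt_add_left ENNReal.coe_ne_top hn₁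
      _ = t := add_tsub_cancel_of_le hy.le
  have hcount : j ≤ stairNum n t := by
    unfold stairNum
    calc j = ∑ k ∈ Finset.range j, 1 := by simp
      _ ≤ ∑ k ∈ Finset.range j,
          (Set.Iio t).indicator (fun _ => (1 : ℕ)) (((k : ℝ≥0∞) + 1) * 2⁻¹ ^ n) := by
          refine Finset.sum_le_sum fun k hk => ?_
          rw [Set.indicator_of_mem]
          rw [Set.mem_Iio]
          refine lt_of_le_of_lt ?_ hjt
          gcongr
          exact_mod_cast Finset.mem_range.1 hk
      _ ≤ _ := Finset.sum_le_sum_of_subset (Finset.range_mono hj4)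
  refine lt_of_lt_of_le ?_ (le_iSup (fun n => stair n t) n)
  calc (z : ℝ≥0∞) < (((j : ℝ≥0) / 2 ^ n : ℝ≥0) : ℝ≥0∞) := by exact_mod_cast hz1
    _ = 2⁻¹ ^ n * (j : ℝ≥0∞) := by rw [← e3, mul_comm]
    _ ≤ stair n t := by unfold stair; gcongr

/-! ### Finite lists of open sets -/

/-- The number of members of a list of open sets that contain a point. -/
noncomputable def cnt (l : List (Opens X)) (x : X) : ℕ :=
  (l.map fun U : Opens X => (U : Set X).indicator (fun _ => 1) x).sum

/-- `level l k` is the open set of points that lie in more than `k` members of the list `l`. -/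
def level : List (Opens X) → ℕ → Opens X
  | [], _ => ⊥
  | U :: l, 0 => level l 0 ⊔ U
  | U :: l, k + 1 => level l (k + 1) ⊔ (U ⊓ level l k)

lemma mem_level (l : List (Opens X)) (k : ℕ) (x : X) : x ∈ level l k ↔ k < cnt l x := by
  classical
  induction l generalizing k with
  | nil => simp [level, cnt]
  | cons U l ih =>
    have hc : cnt (U :: l) x = (U : Set X).indicator (fun _ => 1) x + cnt l x := by simp [cnt]
    rw [hc]
    cases k with
    | zero =>
      by_cases h : x ∈ U
      · simp [level, Opens.mem_sup, h]
      · simp [level, Opens.mem_sup, h, ih]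
    | succ k =>
      by_cases h : x ∈ U
      · simp only [level, Opens.mem_sup, Opens.mem_inf, ih, h, true_and, SetLike.mem_coe,
          Set.indicator_of_mem]
        omega
      · simp [level, Opens.mem_sup, h, ih]

lemma map_mono (ν : ContinuousValuation X) {U V : Opens X} (h : U ≤ V) : ν U ≤ ν V := ν.mono' U V h

lemma level_succ_le (l : List (Opens X)) (k : ℕ) : level l (k + 1) ≤ level l k := by
  intro x hx
  have h := (mem_level l (k + 1) x).1 hx
  exact (mem_level l k x).2 (by omega)

lemma cnt_le_length (l : List (Opens X)) (x : X) : cnt l x ≤ l.length := by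
  classical
  induction l with
  | nil => simp [cnt]
  | cons U l ih =>
    have hc : cnt (U :: l) x = (U : Set X).indicator (fun _ => 1) x + cnt l x := by simp [cnt]
    have h1 : (U : Set X).indicator (fun _ => 1) x ≤ 1 := by
      unfold Set.indicator; split_ifs <;> simp
    rw [hc, List.length_cons]; omega

lemma level_eq_bot (l : List (Opens X)) (k : ℕ) (hk : l.length ≤ k) : level l k = ⊥ := by
  ext x
  have h := cnt_le_length l x
  simp only [SetLike.mem_coe, mem_level, Opens.mem_bot, iff_false]
  omega

lemma sum_level_cons (ν : ContinuousValuation X) (U : Opens X) (l : List (Opens X)) (n : ℕ) :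
    (∑ k ∈ Finset.range (n + 1), ν (level (U :: l) k)) + ν (U ⊓ level l n) =
      ν U + ∑ k ∈ Finset.range (n + 1), ν (level l k) := by
  induction n with
  | zero =>
    simp only [zero_add, Finset.range_one, Finset.sum_singleton, level]
    rw [inf_comm, ν.modular', add_comm]
  | succ n ih =>
    rw [Finset.sum_range_succ, Finset.sum_range_succ (fun k => ν (level l k)), ← add_assoc, ← ih]
    have hm := ν.modular' (level l (n + 1)) (U ⊓ level l n)
    have he : level l (n + 1) ⊓ (U ⊓ level l n) = U ⊓ level l (n + 1) := by
      rw [inf_left_comm, inf_eq_left.2 (level_succ_le l n)]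
    rw [he] at hm
    simp only [level]
    rw [add_assoc, hm, add_assoc]
    congr 1
    exact add_comm _ _

lemma sum_eq_sum_level (ν : ContinuousValuation X) (l : List (Opens X)) (n : ℕ)
    (hn : l.length ≤ n) : (l.map ν.toFun).sum = ∑ k ∈ Finset.range (n + 1), ν (level l k) := by
  induction l with
  | nil => simp [level, ν.map_bot']
  | cons U l ih =>
    rw [List.length_cons] at hn
    have h := sum_level_cons ν U l n
    rw [level_eq_bot l n (by omega), inf_bot_eq, ν.map_bot', add_zero, ← ih (by omega)] at h
    rw [h]; simp

lemma sum_le_of_cnt_le (ν : ContinuousValuation X) (l l' : List (Opens X))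
    (h : ∀ x, cnt l x ≤ cnt l' x) : (l.map ν.toFun).sum ≤ (l'.map ν.toFun).sum := by
  rw [sum_eq_sum_level ν l (max l.length l'.length) (le_max_left _ _),
    sum_eq_sum_level ν l' (max l.length l'.length) (le_max_right _ _)]
  refine Finset.sum_le_sum fun k _ => ν.map_mono fun x hx => ?_
  exact (mem_level l' k x).2 (((mem_level l k x).1 hx).trans_le (h x))

lemma exists_list {n : ℕ} (m : Fin n → ℕ) (U : Fin n → Opens X) :
    ∃ l : List (Opens X), ∀ w : Opens X → ℝ≥0∞,
      (l.map w).sum = ∑ i, (m i : ℝ≥0∞) * w (U i) := by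
  refine ⟨(List.ofFn fun i => List.replicate (m i) (U i)).flatten, fun w => ?_⟩
  rw [List.map_flatten, List.sum_flatten, List.map_map, List.map_ofFn, List.sum_ofFn]
  simp

lemma cast_cnt (l : List (Opens X)) (x : X) :
    (cnt l x : ℝ≥0∞) = (l.map fun U : Opens X => (U : Set X).indicator (1 : X → ℝ≥0∞) x).sum := by
  classical
  unfold cnt
  induction l with
  | nil => simp
  | cons U l ih =>
    simp only [List.map_cons, List.sum_cons, Nat.cast_add, ih]
    congr 1
    by_cases h : x ∈ (U : Set X) <;> simp [h]

/-! ### Basic properties of the lower integral -/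

lemma le_integral (ν : ContinuousValuation X) (g : X → ℝ≥0∞) {n : ℕ} (r : Fin n → ℝ≥0∞)
    (U : Fin n → Opens X) (h : ∀ x, ∑ i, r i * (U i : Set X).indicator 1 x ≤ g x) :
    ∑ i, r i * ν (U i) ≤ ν.integral g :=
  le_iSup_of_le n (le_iSup_of_le r (le_iSup_of_le U (le_iSup_of_le h le_rfl)))

lemma le_integral_list (ν : ContinuousValuation X) (g : X → ℝ≥0∞) (c : ℝ≥0∞) (l : List (Opens X))
    (h : ∀ x, c * (cnt l x : ℝ≥0∞) ≤ g x) : c * (l.map ν.toFun).sum ≤ ν.integral g := by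
  have e : ∀ w : Opens X → ℝ≥0∞, ∑ i : Fin l.length, c * w (l.get i) = c * (l.map w).sum := by
    intro w
    rw [← Finset.mul_sum, ← List.sum_ofFn]
    congr 2
    conv_rhs => rw [← List.ofFn_get l]
    rw [List.map_ofFn]
    rfl
  rw [← e]
  refine le_integral ν g (fun _ => c) l.get fun x => ?_
  have := e (fun V => (V : Set X).indicator (1 : X → ℝ≥0∞) x)
  rw [this, ← cast_cnt]
  exact h x

lemma integral_le (ν : ContinuousValuation X) (g : X → ℝ≥0∞) (y : ℝ≥0∞)
    (h : ∀ (n : ℕ) (l : List (Opens X)),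
      (∀ x, 0 < cnt l x → 2⁻¹ ^ n * (cnt l x : ℝ≥0∞) < g x) →
      2⁻¹ ^ n * (l.map ν.toFun).sum ≤ y) : ν.integral g ≤ y := by
  refine iSup_le fun N => iSup_le fun r => iSup_le fun U => iSup_le fun hg => ?_
  have e : ∑ i, r i * ν (U i) = ⨆ n, ∑ i, stair n (r i) * ν (U i) := by
    rw [← ENNReal.finsetSum_iSup_of_monotone]
    · refine Finset.sum_congr rfl fun i _ => ?_
      rw [← ENNReal.iSup_mul, iSup_stair]
    · intro i a b hab
      exact mul_le_mul_left (stair_mono (r i) hab) _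
  rw [e]
  refine iSup_le fun n => ?_
  obtain ⟨l, hl⟩ := exists_list (fun i => stairNum n (r i)) U
  have e2 : ∀ w : Opens X → ℝ≥0∞, ∑ i, stair n (r i) * w (U i) = 2⁻¹ ^ n * (l.map w).sum := by
    intro w
    rw [hl, Finset.mul_sum]
    refine Finset.sum_congr rfl fun i _ => ?_
    rw [stair, mul_assoc]
  rw [e2]
  refine h n l fun x hx => lt_of_lt_of_le ?_ (hg x)
  rw [cast_cnt, ← e2 (fun V => (V : Set X).indicator (1 : X → ℝ≥0∞) x)]
  classical
  have hpos : (∑ i, stair n (r i) * (U i : Set X).indicator (1 : X → ℝ≥0∞) x) ≠ 0 := by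
    rw [e2 (fun V => (V : Set X).indicator (1 : X → ℝ≥0∞) x), ← cast_cnt]
    exact mul_ne_zero (two_inv_pow_ne_zero n) (by exact_mod_cast hx.ne')
  rw [← Finset.sum_filter_ne_zero]
  refine lt_of_lt_of_le (ENNReal.sum_lt_sum_of_nonempty (g := fun i =>
      r i * (U i : Set X).indicator (1 : X → ℝ≥0∞) x) ?_ ?_) ?_
  · rw [Finset.nonempty_iff_ne_empty]
    intro h0
    rw [← Finset.sum_filter_ne_zero, h0, Finset.sum_empty] at hpos
    exact hpos rfl
  · intro i hi
    have hi := (Finset.mem_filter.1 hi).2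
    by_cases hx : x ∈ (U i : Set X)
    · simp only [hx, Set.indicator_of_mem, Pi.one_apply, mul_one] at hi ⊢
      exact (stair_lt n (r i)).resolve_left hi
    · simp [hx] at hi
  · exact Finset.sum_le_sum_of_subset (Finset.filter_subset _ _)

lemma integral_mono (ν : ContinuousValuation X) {f g : X → ℝ≥0∞} (h : ∀ x, f x ≤ g x) :
    ν.integral f ≤ ν.integral g :=
  iSup_le fun _ => iSup_le fun r => iSup_le fun U => iSup_le fun hf =>
    ν.le_integral g r U fun x => (hf x).trans (h x)

/-- The integral of a dyadic simple function does not depend on its representation. -/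
lemma integral_list (ν : ContinuousValuation X) (n : ℕ) (l : List (Opens X)) :
    ν.integral (fun x => 2⁻¹ ^ n * (cnt l x : ℝ≥0∞)) = 2⁻¹ ^ n * (l.map ν.toFun).sum := by
  refine le_antisymm (ν.integral_le _ _ fun N l' h => ?_) (ν.le_integral_list _ _ _ fun x => le_rfl)
  have rep : ∀ (k : ℕ) (L : List (Opens X)), ∀ w : Opens X → ℝ≥0∞,
      ((List.replicate k L).flatten.map w).sum = (k : ℝ≥0∞) * (L.map w).sum := by
    intro k L w
    rw [List.map_flatten, List.sum_flatten, List.map_map]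
    simp
  have hc : ∀ x, cnt (List.replicate (2 ^ n) l').flatten x ≤
      cnt (List.replicate (2 ^ N) l).flatten x := by
    intro x
    suffices hs : (cnt (List.replicate (2 ^ n) l').flatten x : ℝ≥0∞) ≤
      cnt (List.replicate (2 ^ N) l).flatten x by exact_mod_cast hs
    rw [cast_cnt, cast_cnt, rep, rep, ← cast_cnt, ← cast_cnt]
    push_cast
    rcases Nat.eq_zero_or_pos (cnt l' x) with h0 | h0
    · simp [h0]
    · have := (h x h0).le
      calc (2 : ℝ≥0∞) ^ n * (cnt l' x : ℝ≥0∞)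
          = 2 ^ n * (2 ^ N * (2⁻¹ ^ N * (cnt l' x : ℝ≥0∞))) := by
            rw [← mul_assoc (2 ^ N), mul_comm (2 ^ N), two_inv_pow_mul, one_mul]
        _ ≤ 2 ^ n * (2 ^ N * (2⁻¹ ^ n * (cnt l x : ℝ≥0∞))) := by gcongr
        _ = (2⁻¹ ^ n * 2 ^ n) * (2 ^ N * (cnt l x : ℝ≥0∞)) := by ring
        _ = _ := by rw [two_inv_pow_mul, one_mul]
  have hs := sum_le_of_cnt_le ν _ _ hc
  rw [rep, rep] at hs
  push_cast at hs
  calc (2⁻¹ ^ N : ℝ≥0∞) * (l'.map ν.toFun).sum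
      = 2⁻¹ ^ N * ((2⁻¹ ^ n * 2 ^ n) * (l'.map ν.toFun).sum) := by rw [two_inv_pow_mul, one_mul]
    _ = 2⁻¹ ^ N * (2⁻¹ ^ n * (2 ^ n * (l'.map ν.toFun).sum)) := by ring
    _ ≤ 2⁻¹ ^ N * (2⁻¹ ^ n * (2 ^ N * (l.map ν.toFun).sum)) := by gcongr
    _ = (2⁻¹ ^ N * 2 ^ N) * (2⁻¹ ^ n * (l.map ν.toFun).sum) := by ring
    _ = _ := by rw [two_inv_pow_mul, one_mul]

/-- The open set `{x | t < g x}` of a lower semicontinuous function. -/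
def superlevel (g : X → ℝ≥0∞) (hg : LowerSemicontinuous g) (t : ℝ≥0∞) : Opens X :=
  ⟨{x | t < g x}, hg.isOpen_preimage t⟩

/-- The first `K` superlevel sets of `g` at the positive multiples of `2 ^ (-n)`. -/
noncomputable def superList (g : X → ℝ≥0∞) (hg : LowerSemicontinuous g) (n K : ℕ) : List (Opens X) :=
  (List.range K).map fun k : ℕ => superlevel g hg (((k : ℝ≥0∞) + 1) * 2⁻¹ ^ n)

lemma sum_superList (g : X → ℝ≥0∞) (hg : LowerSemicontinuous g) (n K : ℕ) {M : Type*}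
    [AddCommMonoid M] (w : Opens X → M) : ((superList g hg n K).map w).sum =
      ∑ k ∈ Finset.range K, w (superlevel g hg (((k : ℝ≥0∞) + 1) * 2⁻¹ ^ n)) := by
  rw [superList, List.map_map, Finset.sum_range, ← List.sum_ofFn]
  congr 1
  apply List.ext_getElem <;> simp

lemma cnt_superList (g : X → ℝ≥0∞) (hg : LowerSemicontinuous g) (n K : ℕ) (x : X) :
    cnt (superList g hg n K) x = ∑ k ∈ Finset.range K,
      (Set.Iio (g x)).indicator (fun _ => (1 : ℕ)) (((k : ℝ≥0∞) + 1) * 2⁻¹ ^ n) := by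
  rw [cnt, sum_superList]
  rfl

lemma integral_iSup (ν : ContinuousValuation X) {ι : Type*} [Nonempty ι] (g : ι → X → ℝ≥0∞)
    (hg : ∀ i, LowerSemicontinuous (g i)) (hd : Directed (· ≤ ·) g) :
    ν.integral (fun x => ⨆ i, g i x) = ⨆ i, ν.integral (g i) := by
  refine le_antisymm (ν.integral_le _ _ fun n l h => ?_)
    (iSup_le fun i => ν.integral_mono fun x => le_iSup (fun i => g i x) i)
  rw [sum_eq_sum_level ν l l.length le_rfl]
  set B : ι → ℕ → Opens X := fun i k => superlevel (g i) (hg i) (((k : ℝ≥0∞) + 1) * 2⁻¹ ^ n)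
  have hB : ∀ i j, g i ≤ g j → ∀ k, B i k ≤ B j k := fun i j hij k x hx =>
    lt_of_lt_of_le (show _ < g i x from hx) (hij x)
  have h1 : ∀ k, ν (level l k) ≤ ⨆ i, ν (B i k) := by
    intro k
    have hs : ν (sSup (Set.range fun i => B i k)) = ⨆ i, ν (B i k) := by
      rw [ν.scott' _ (Set.range_nonempty _), iSup_range]
      rintro _ ⟨i, rfl⟩ _ ⟨j, rfl⟩
      obtain ⟨m, hi, hj⟩ := hd i j
      exact ⟨B m k, ⟨m, rfl⟩, hB i m hi k, hB j m hj k⟩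
    rw [← hs]
    refine ν.map_mono fun x hx => ?_
    have hx := (mem_level l k x).1 hx
    have h2 := h x (by omega)
    have h3 : ((k : ℝ≥0∞) + 1) * 2⁻¹ ^ n < ⨆ i, g i x := by
      refine lt_of_le_of_lt ?_ h2
      rw [mul_comm]
      gcongr
      exact_mod_cast hx
    obtain ⟨i, hi⟩ := lt_iSup_iff.1 h3
    exact Opens.mem_sSup.2 ⟨B i k, ⟨i, rfl⟩, hi⟩
  calc (2⁻¹ ^ n : ℝ≥0∞) * ∑ k ∈ Finset.range (l.length + 1), ν (level l k)
      ≤ 2⁻¹ ^ n * ∑ k ∈ Finset.range (l.length + 1), ⨆ i, ν (B i k) := by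
        gcongr with k _
        exact h1 k
    _ = 2⁻¹ ^ n * ⨆ i, ∑ k ∈ Finset.range (l.length + 1), ν (B i k) := by
        rw [ENNReal.finsetSum_iSup]
        intro i j
        obtain ⟨m, hi, hj⟩ := hd i j
        exact ⟨m, fun k => ⟨ν.map_mono (hB i m hi k), ν.map_mono (hB j m hj k)⟩⟩
    _ = ⨆ i, 2⁻¹ ^ n * ∑ k ∈ Finset.range (l.length + 1), ν (B i k) := ENNReal.mul_iSup ..
    _ ≤ ⨆ i, ν.integral (g i) := by
        refine iSup_mono fun i => ?_
        have := ν.le_integral_list (g i) (2⁻¹ ^ n) (superList (g i) (hg i) n (l.length + 1)) ?_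
        · rwa [sum_superList] at this
        · intro x
          rw [cnt_superList, mul_comm]
          rcases count_lt (2⁻¹ ^ n) (g i x) (l.length + 1) with h0 | h0
          · simp [h0]
          · exact h0.le

lemma stair_eq_cnt (g : X → ℝ≥0∞) (hg : LowerSemicontinuous g) (n : ℕ) (x : X) :
    stair n (g x) = 2⁻¹ ^ n * (cnt (superList g hg n (4 ^ n)) x : ℝ≥0∞) := by
  rw [cnt_superList]; rfl

lemma lsc_cnt (n : ℕ) (l : List (Opens X)) :
    LowerSemicontinuous fun x => (2⁻¹ ^ n : ℝ≥0∞) * (cnt l x : ℝ≥0∞) := by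
  refine (ENNReal.continuous_const_mul (two_inv_pow_ne_top n)).comp_lowerSemicontinuous ?_
    (fun a b hab => mul_le_mul_right hab _)
  intro x y hy
  have h0 : 0 < cnt l x := by
    by_contra h0
    have : cnt l x = 0 := by omega
    simp [this] at hy
  have hx : x ∈ level l (cnt l x - 1) := (mem_level _ _ _).2 (by omega)
  filter_upwards [(level l (cnt l x - 1)).isOpen.mem_nhds hx] with z hz
  have hz := (mem_level _ _ _).1 hz
  refine lt_of_lt_of_le hy ?_
  have : cnt l x ≤ cnt l z := by omega
  exact Nat.cast_le.2 this

lemma lsc_stair (g : X → ℝ≥0∞) (hg : LowerSemicontinuous g) (n : ℕ) :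
    LowerSemicontinuous fun x => stair n (g x) := by
  simp_rw [stair_eq_cnt g hg]
  exact lsc_cnt _ _

lemma integral_stair (ν : ContinuousValuation X) (g : X → ℝ≥0∞) (hg : LowerSemicontinuous g)
    (n : ℕ) : ν.integral (fun x => stair n (g x)) =
      2⁻¹ ^ n * ((superList g hg n (4 ^ n)).map ν.toFun).sum := by
  simp_rw [stair_eq_cnt g hg]
  exact integral_list ν n _

lemma integral_eq (ν : ContinuousValuation X) (g : X → ℝ≥0∞) (hg : LowerSemicontinuous g) :
    ν.integral g = ⨆ n, 2⁻¹ ^ n *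
      ∑ k ∈ Finset.range (4 ^ n), ν (superlevel g hg (((k : ℝ≥0∞) + 1) * 2⁻¹ ^ n)) := by
  have h := ν.integral_iSup (fun n x => stair n (g x)) (lsc_stair g hg)
    (Monotone.directed_le fun a b hab x => stair_mono (g x) hab)
  simp_rw [iSup_stair, integral_stair ν g hg, sum_superList] at h
  exact h

lemma integral_add (ν : ContinuousValuation X) (f g : X → ℝ≥0∞) (hf : LowerSemicontinuous f)
    (hg : LowerSemicontinuous g) :
    ν.integral (fun x => f x + g x) = ν.integral f + ν.integral g := by
  have e : ∀ n x, stair n (f x) + stair n (g x) =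
      2⁻¹ ^ n * (cnt (superList f hf n (4 ^ n) ++ superList g hg n (4 ^ n)) x : ℝ≥0∞) := by
    intro n x
    rw [stair_eq_cnt f hf, stair_eq_cnt g hg, ← mul_add]
    simp [cnt]
  have hm : ∀ a b, a ≤ b → ∀ x, stair a (f x) + stair a (g x) ≤ stair b (f x) + stair b (g x) :=
    fun a b hab x => add_le_add (stair_mono (f x) hab) (stair_mono (g x) hab)
  have h := ν.integral_iSup (fun n x => stair n (f x) + stair n (g x))
    (fun n => by simp_rw [e]; exact lsc_cnt _ _) (Monotone.directed_le hm)
  have e1 : ∀ x, ⨆ n, (stair n (f x) + stair n (g x)) = f x + g x := by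
    intro x
    rw [← ENNReal.iSup_add_iSup_of_monotone (stair_mono _) (stair_mono _), iSup_stair, iSup_stair]
  simp_rw [e1] at h
  rw [h]
  have e2 : ∀ n, ν.integral (fun x => stair n (f x) + stair n (g x)) =
      ν.integral (fun x => stair n (f x)) + ν.integral (fun x => stair n (g x)) := by
    intro n
    simp_rw [e]
    rw [integral_list, integral_stair ν f hf, integral_stair ν g hg, List.map_append,
      List.sum_append, mul_add]
  simp_rw [e2]
  rw [← ENNReal.iSup_add_iSup_of_monotone
      (fun a b hab => ν.integral_mono fun x => stair_mono (f x) hab)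
      (fun a b hab => ν.integral_mono fun x => stair_mono (g x) hab),
    ← ν.integral_iSup (fun n x => stair n (f x)) (lsc_stair f hf)
      (Monotone.directed_le fun a b hab x => stair_mono (f x) hab),
    ← ν.integral_iSup (fun n x => stair n (g x)) (lsc_stair g hg)
      (Monotone.directed_le fun a b hab x => stair_mono (g x) hab)]
  simp_rw [iSup_stair]

lemma integral_zero (ν : ContinuousValuation X) : ν.integral (fun _ => 0) = 0 := by
  simpa [cnt] using integral_list ν 0 ([] : List (Opens X))

lemma integral_finset_sum (ν : ContinuousValuation X) (f : ℕ → X → ℝ≥0∞)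
    (hf : ∀ k, LowerSemicontinuous (f k)) (K : ℕ) :
    ν.integral (fun x => ∑ k ∈ Finset.range K, f k x) = ∑ k ∈ Finset.range K, ν.integral (f k) := by
  induction K with
  | zero => simpa using ν.integral_zero
  | succ K ih =>
    simp_rw [Finset.sum_range_succ]
    rw [integral_add ν _ _ (lowerSemicontinuous_sum fun k _ => hf k) (hf K), ih]

lemma mul_integral_le (ν : ContinuousValuation X) (c : ℝ≥0∞) (g : X → ℝ≥0∞) :
    c * ν.integral g ≤ ν.integral (fun x => c * g x) := by
  simp only [integral, ENNReal.mul_iSup]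
  refine iSup_le fun N => iSup_le fun r => iSup_le fun U => iSup_le fun hg => ?_
  rw [Finset.mul_sum]
  simp_rw [← mul_assoc]
  refine ν.le_integral _ (fun i => c * r i) U fun x => ?_
  simp_rw [mul_assoc]
  rw [← Finset.mul_sum]
  exact mul_le_mul_right (hg x) _

lemma integral_dyadic_mul (ν : ContinuousValuation X) (n : ℕ) (g : X → ℝ≥0∞) :
    ν.integral (fun x => 2⁻¹ ^ n * g x) = 2⁻¹ ^ n * ν.integral g := by
  refine le_antisymm ?_ (ν.mul_integral_le _ _)
  have h := ν.mul_integral_le (2 ^ n) (fun x => 2⁻¹ ^ n * g x)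
  simp_rw [← mul_assoc, mul_comm (2 ^ n : ℝ≥0∞) (2⁻¹ ^ n), two_inv_pow_mul, one_mul] at h
  calc ν.integral (fun x => 2⁻¹ ^ n * g x)
      = 2⁻¹ ^ n * (2 ^ n * ν.integral (fun x => 2⁻¹ ^ n * g x)) := by
        rw [← mul_assoc, two_inv_pow_mul, one_mul]
    _ ≤ _ := mul_le_mul_right h _

/-! ### The functor `V` and its monad structure -/

lemma ext_of {ν ρ : ContinuousValuation X} (h : ∀ U, ν U = ρ U) : ν = ρ :=
  ContinuousValuation.ext (funext h)

lemma isOpen_theta (U : Opens X) (y : ℝ≥0∞) : IsOpen {ν : ContinuousValuation X | y < ν U} := by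
  induction y with
  | top => simp
  | coe r => exact isOpen_generateFrom_of_mem ⟨U, r, rfl⟩

lemma lsc_eval (U : Opens X) : LowerSemicontinuous fun ν : ContinuousValuation X => ν U :=
  lowerSemicontinuous_iff_isOpen_preimage.2 fun y => isOpen_theta U y

lemma continuous_of_lsc {f : Y → ContinuousValuation X}
    (h : ∀ U, LowerSemicontinuous fun y => f y U) : Continuous f := by
  refine continuous_generateFrom_iff.2 ?_
  rintro _ ⟨U, r, rfl⟩
  exact (h U).isOpen_preimage r

lemma lsc_integral (g : X → ℝ≥0∞) (hg : LowerSemicontinuous g) :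
    LowerSemicontinuous fun ν : ContinuousValuation X => ν.integral g := by
  simp_rw [fun ν : ContinuousValuation X => integral_eq ν g hg]
  refine lowerSemicontinuous_iSup fun n => ?_
  refine (ENNReal.continuous_const_mul (two_inv_pow_ne_top n)).comp_lowerSemicontinuous ?_
    (fun a b hab => mul_le_mul_right hab _)
  exact lowerSemicontinuous_sum fun k _ => lsc_eval _

/-- The pushforward `f_* ν`, with `f_* ν (U) = ν (f⁻¹ U)`. -/
def map (f : C(X, Y)) (ν : ContinuousValuation X) : ContinuousValuation Y where
  toFun U := ν (U.comap f)
  map_bot' := by rw [map_bot]; exact ν.map_bot'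
  mono' U V h := ν.map_mono (Opens.comap_mono f h)
  modular' U V := by rw [map_sup, map_inf]; exact ν.modular' _ _
  scott' D hD hd := by
    rw [map_sSup, ν.scott' _ (hD.image _), iSup_image]
    rintro _ ⟨U, hU, rfl⟩ _ ⟨V, hV, rfl⟩
    obtain ⟨W, hW, h1, h2⟩ := hd U hU V hV
    exact ⟨_, ⟨W, hW, rfl⟩, Opens.comap_mono f h1, Opens.comap_mono f h2⟩

lemma continuous_map (f : C(X, Y)) : Continuous (map f) :=
  continuous_of_lsc fun U => lsc_eval (U.comap f)

lemma integral_map (f : C(X, Y)) (ν : ContinuousValuation X) (g : Y → ℝ≥0∞)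
    (hg : LowerSemicontinuous g) : (map f ν).integral g = ν.integral (fun x => g (f x)) := by
  rw [integral_eq _ g hg, integral_eq ν (fun x => g (f x)) (hg.comp f.continuous)]
  rfl

/-- The Dirac valuation `δ_x`, with `δ_x (U) = 1` if `x ∈ U` and `0` otherwise. -/
noncomputable def dirac (x : X) : ContinuousValuation X where
  toFun U := (U : Set X).indicator 1 x
  map_bot' := by simp
  mono' U V h := Set.indicator_le_indicator_of_subset h (fun _ => zero_le) x
  modular' U V := by
    by_cases h1 : x ∈ U <;> by_cases h2 : x ∈ V <;> simp [h1, h2]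
  scott' D _ _ := by
    classical
    by_cases h : x ∈ sSup D
    · obtain ⟨U, hU, hx⟩ := Opens.mem_sSup.1 h
      rw [Set.indicator_of_mem (by exact h)]
      refine le_antisymm (le_iSup₂_of_le U hU ?_) (iSup₂_le fun V _ => ?_)
      · rw [Set.indicator_of_mem (by exact hx)]
      · exact Set.indicator_le_self' (fun _ _ => zero_le) x
    · rw [Set.indicator_of_notMem (by exact h)]
      refine (le_antisymm (iSup₂_le fun V hV => ?_) (zero_le)).symm
      rw [Set.indicator_of_notMem]
      exact fun hx => h (Opens.mem_sSup.2 ⟨V, hV, hx⟩)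

lemma continuous_dirac : Continuous (dirac : X → ContinuousValuation X) :=
  continuous_of_lsc fun U => U.isOpen.lowerSemicontinuous_indicator (zero_le)

/-- `∫ g dδ_x = g x`. -/
lemma integral_dirac (x : X) (g : X → ℝ≥0∞) (hg : LowerSemicontinuous g) :
    (dirac x).integral g = g x := by
  have h := integral_eq (dirac x) g hg
  rw [h]
  conv_rhs => rw [← iSup_stair (g x)]
  refine iSup_congr fun n => ?_
  rw [stair_eq_cnt g hg, cast_cnt, sum_superList]
  rfl

/-- The valuation `ℰ ξ ∈ VX` of `ξ ∈ VVX`, with `ℰ ξ (U) = ∫ ν (U) dξ(ν)`; see also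
`integral_join`. -/
noncomputable def join (ξ : ContinuousValuation (ContinuousValuation X)) :
    ContinuousValuation X where
  toFun U := ξ.integral (fun ν => ν U)
  map_bot' := by
    simp_rw [fun ν : ContinuousValuation X => ν.map_bot']
    exact ξ.integral_zero
  mono' U V h := ξ.integral_mono fun ν => ν.map_mono h
  modular' U V := by
    rw [← integral_add _ _ _ (lsc_eval _) (lsc_eval _),
      ← integral_add _ _ _ (lsc_eval _) (lsc_eval _)]
    simp_rw [fun ν : ContinuousValuation X => ν.modular' U V]
  scott' D hD hd := by
    simp_rw [fun ν : ContinuousValuation X => ν.scott' D hD hd, iSup_subtype']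
    have : Nonempty D := hD.to_subtype
    refine ξ.integral_iSup (fun (U : D) (ν : ContinuousValuation X) => ν U) (fun U => lsc_eval _) ?_
    rintro ⟨U, hU⟩ ⟨V, hV⟩
    obtain ⟨W, hW, h1, h2⟩ := hd U hU V hV
    exact ⟨⟨W, hW⟩, fun ν => ν.map_mono h1, fun ν => ν.map_mono h2⟩

lemma continuous_join :
    Continuous (join : ContinuousValuation (ContinuousValuation X) → ContinuousValuation X) :=
  continuous_of_lsc fun U => lsc_integral _ (lsc_eval U)

/-- The defining property of `ℰ`: `∫ g d(ℰ ξ) = ∫ (∫ g dν) dξ(ν)` for all lower semicontinuous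
`g`. -/
lemma integral_join (ξ : ContinuousValuation (ContinuousValuation X)) (g : X → ℝ≥0∞)
    (hg : LowerSemicontinuous g) : (join ξ).integral g = ξ.integral (fun ν => ν.integral g) := by
  have h1 : ∀ n, LowerSemicontinuous fun ν : ContinuousValuation X =>
      ν.integral (fun x => stair n (g x)) := fun n => lsc_integral _ (lsc_stair g hg n)
  have h2 := ξ.integral_iSup (fun n (ν : ContinuousValuation X) =>
    ν.integral (fun x => stair n (g x))) h1
    (Monotone.directed_le fun a b hab ν => ν.integral_mono fun x => stair_mono (g x) hab)
  have h3 : ∀ ν : ContinuousValuation X,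
      ⨆ n, ν.integral (fun x => stair n (g x)) = ν.integral g := by
    intro ν
    rw [integral_eq ν g hg]
    simp_rw [integral_stair ν g hg, sum_superList]
  simp_rw [h3] at h2
  rw [h2, integral_eq _ g hg]
  refine iSup_congr fun n => ?_
  simp_rw [fun ν : ContinuousValuation X => integral_stair ν g hg n, sum_superList]
  rw [integral_dyadic_mul, integral_finset_sum _ _ fun k => lsc_eval _]
  rfl

end ContinuousValuation

/-- The hyperspace `HX`: the type of closed subsets of `X`, including the empty set. -/
@[ext]
structure Hyperspace (X : Type u) [TopologicalSpace X] where
  carrier : Set X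
  isClosed' : IsClosed carrier

namespace Hyperspace

variable {X Y : Type u} [TopologicalSpace X] [TopologicalSpace Y]

instance : SetLike (Hyperspace X) X where
  coe := carrier
  coe_injective _ _ h := Hyperspace.ext h

/-- The set `Hit(U)` of closed sets `C` with `C ∩ U ≠ ∅`. -/
def hit (U : Opens X) : Set (Hyperspace X) := {C | ((C : Set X) ∩ U).Nonempty}

/-- The lower Vietoris topology, generated by the sets `Hit(U)` for `U` open. -/
instance : TopologicalSpace (Hyperspace X) :=
  generateFrom {S | ∃ U : Opens X, S = hit U}

/-- The closure of a set, as a point of the hyperspace. -/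
def cl (A : Set X) : Hyperspace X := ⟨closure A, isClosed_closure⟩

lemma isOpen_hit (U : Opens X) : IsOpen (hit U) := isOpen_generateFrom_of_mem ⟨U, rfl⟩

/-- `Hit(U)` as an open subset of the hyperspace. -/
def hitOpens (U : Opens X) : Opens (Hyperspace X) := ⟨hit U, isOpen_hit U⟩

lemma cl_mem_hit (A : Set X) (U : Opens X) : cl A ∈ hit U ↔ (A ∩ U).Nonempty :=
  closure_inter_open_nonempty_iff U.isOpen

lemma ext_hit {C D : Hyperspace X} (h : ∀ U : Opens X, C ∈ hit U ↔ D ∈ hit U) : C = D := by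
  have key : ∀ C D : Hyperspace X, (∀ U : Opens X, C ∈ hit U → D ∈ hit U) →
      (C : Set X) ⊆ D := by
    intro C D h x hx
    by_contra hxD
    obtain ⟨y, hy, hy'⟩ := h ⟨(D : Set X)ᶜ, D.isClosed'.isOpen_compl⟩ ⟨x, hx, hxD⟩
    exact hy' hy
  exact SetLike.coe_injective
    ((key C D fun U => (h U).1).antisymm (key D C fun U => (h U).2))

/-- The map `f_♯` sending a closed set to the closure of its image. -/
def map (f : X → Y) (C : Hyperspace X) : Hyperspace Y := cl (f '' C)

/-- The unit `σ`, sending `x` to the closure of `{x}`. -/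
def unit (x : X) : Hyperspace X := cl {x}

/-- The multiplication `𝒰`, sending a closed set of closed sets to the closure of its union. -/
def join (K : Hyperspace (Hyperspace X)) : Hyperspace X := cl (⋃ C ∈ K, (C : Set X))

lemma map_mem_hit (f : C(X, Y)) (C : Hyperspace X) (U : Opens Y) :
    map f C ∈ hit U ↔ C ∈ hit (U.comap f) := by
  rw [map, cl_mem_hit, Set.image_inter_nonempty_iff]
  rfl

lemma unit_mem_hit (x : X) (U : Opens X) : unit x ∈ hit U ↔ x ∈ U := by
  rw [unit, cl_mem_hit, Set.singleton_inter_nonempty]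
  rfl

lemma join_mem_hit (K : Hyperspace (Hyperspace X)) (U : Opens X) :
    join K ∈ hit U ↔ K ∈ hit (hitOpens U) := by
  rw [join, cl_mem_hit]
  constructor
  · rintro ⟨x, hx, hU⟩
    obtain ⟨C, hC, hx⟩ := Set.mem_iUnion₂.1 hx
    exact ⟨C, hC, x, hx, hU⟩
  · rintro ⟨C, hC, x, hx, hU⟩
    exact ⟨x, Set.mem_iUnion₂.2 ⟨C, hC, hx⟩, hU⟩

lemma continuous_of_hit {f : Y → Hyperspace X} (h : ∀ U, IsOpen (f ⁻¹' hit U)) :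
    Continuous f := by
  refine continuous_generateFrom_iff.2 ?_
  rintro _ ⟨U, rfl⟩
  exact h U

lemma continuous_map (f : C(X, Y)) : Continuous (map f) := by
  refine continuous_of_hit fun U => ?_
  have : map f ⁻¹' hit U = hit (U.comap f) := Set.ext fun C => map_mem_hit f C U
  rw [this]
  exact isOpen_hit _

lemma continuous_unit : Continuous (unit : X → Hyperspace X) := by
  refine continuous_of_hit fun U => ?_
  have : unit ⁻¹' hit U = (U : Set X) := Set.ext fun x => unit_mem_hit x U
  rw [this]
  exact U.isOpen

lemma continuous_join : Continuous (join : Hyperspace (Hyperspace X) → Hyperspace X) := by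
  refine continuous_of_hit fun U => ?_
  have : join ⁻¹' hit U = hit (hitOpens U) := Set.ext fun K => join_mem_hit K U
  rw [this]
  exact isOpen_hit _

lemma comap_map_hitOpens (f : C(X, Y)) (U : Opens Y) :
    (hitOpens U).comap ⟨map f, continuous_map f⟩ = hitOpens (U.comap f) :=
  Opens.ext (Set.ext fun C => map_mem_hit f C U)

lemma comap_unit_hitOpens (U : Opens X) :
    (hitOpens U).comap ⟨unit, continuous_unit⟩ = U :=
  Opens.ext (Set.ext fun x => unit_mem_hit x U)

lemma comap_join_hitOpens (U : Opens X) :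
    (hitOpens U).comap ⟨join, continuous_join⟩ = hitOpens (hitOpens U) :=
  Opens.ext (Set.ext fun K => join_mem_hit K U)

end Hyperspace

/-- The valuation monad `(V, δ, ℰ)` on the category of topological spaces. -/
noncomputable def valuationMonad : Monad TopCat.{u} where
  obj X := TopCat.of (ContinuousValuation X)
  map f := TopCat.ofHom ⟨ContinuousValuation.map f.hom, ContinuousValuation.continuous_map f.hom⟩
  map_id _ := rfl
  map_comp _ _ := rfl
  η :=
    { app := fun X => TopCat.ofHom
        ⟨ContinuousValuation.dirac, ContinuousValuation.continuous_dirac⟩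
      naturality := fun _ _ _ => rfl }
  μ :=
    { app := fun X => TopCat.ofHom ⟨ContinuousValuation.join, ContinuousValuation.continuous_join⟩
      naturality := fun X Y f => by
        refine TopCat.hom_ext (ContinuousMap.ext fun ξ => ContinuousValuation.ext_of fun U => ?_)
        exact ContinuousValuation.integral_map
          ⟨ContinuousValuation.map f.hom, ContinuousValuation.continuous_map f.hom⟩ ξ _
          (ContinuousValuation.lsc_eval U) }
  assoc X := by
    refine TopCat.hom_ext (ContinuousMap.ext fun ξ => ContinuousValuation.ext_of fun U => ?_)
    refine (ContinuousValuation.integral_map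
      ⟨ContinuousValuation.join, ContinuousValuation.continuous_join⟩ ξ _
      (ContinuousValuation.lsc_eval U)).trans ?_
    exact (ContinuousValuation.integral_join ξ _ (ContinuousValuation.lsc_eval U)).symm
  left_unit X := by
    refine TopCat.hom_ext (ContinuousMap.ext fun ν => ContinuousValuation.ext_of fun U => ?_)
    exact ContinuousValuation.integral_dirac ν _ (ContinuousValuation.lsc_eval U)
  right_unit X := by
    refine TopCat.hom_ext (ContinuousMap.ext fun ν => ContinuousValuation.ext_of fun U => ?_)
    refine (ContinuousValuation.integral_map
      ⟨ContinuousValuation.dirac, ContinuousValuation.continuous_dirac⟩ ν _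
      (ContinuousValuation.lsc_eval U)).trans ?_
    have h := ContinuousValuation.integral_list ν 0 [U]
    have e : (fun x => (ContinuousValuation.dirac x).toFun U) =
        fun x => 2⁻¹ ^ 0 * (ContinuousValuation.cnt [U] x : ℝ≥0∞) := by
      funext x
      rw [ContinuousValuation.cast_cnt]
      simp [ContinuousValuation.dirac]
    refine (congrArg ν.integral e).trans (h.trans ?_)
    simp

/-- The hyperspace monad `(H, σ, 𝒰)` on the category of topological spaces. -/
def hyperspaceMonad : Monad TopCat.{u} where
  obj X := TopCat.of (Hyperspace X)
  map f := TopCat.ofHom ⟨Hyperspace.map f.hom, Hyperspace.continuous_map f.hom⟩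
  map_id X := by
    refine TopCat.hom_ext (ContinuousMap.ext fun C => Hyperspace.ext_hit fun U => ?_)
    exact Hyperspace.map_mem_hit (ContinuousMap.id X) C U
  map_comp f g := by
    refine TopCat.hom_ext (ContinuousMap.ext fun C => Hyperspace.ext_hit fun U => ?_)
    refine (Hyperspace.map_mem_hit (g.hom.comp f.hom) C U).trans ?_
    exact ((Hyperspace.map_mem_hit g.hom _ U).trans (Hyperspace.map_mem_hit f.hom C _)).symm
  η :=
    { app := fun X => TopCat.ofHom ⟨Hyperspace.unit, Hyperspace.continuous_unit⟩
      naturality := fun X Y f => by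
        refine TopCat.hom_ext (ContinuousMap.ext fun x => Hyperspace.ext_hit fun U => ?_)
        refine (Hyperspace.unit_mem_hit (f x) U).trans ?_
        exact ((Hyperspace.map_mem_hit f.hom _ U).trans (Hyperspace.unit_mem_hit x _)).symm }
  μ :=
    { app := fun X => TopCat.ofHom ⟨Hyperspace.join, Hyperspace.continuous_join⟩
      naturality := fun X Y f => by
        refine TopCat.hom_ext (ContinuousMap.ext fun K => Hyperspace.ext_hit fun U => ?_)
        refine (Hyperspace.join_mem_hit _ U).trans ?_
        refine (Hyperspace.map_mem_hit
          ⟨Hyperspace.map f.hom, Hyperspace.continuous_map f.hom⟩ K _).trans ?_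
        rw [Hyperspace.comap_map_hitOpens]
        exact ((Hyperspace.map_mem_hit f.hom _ U).trans (Hyperspace.join_mem_hit K _)).symm }
  assoc X := by
    refine TopCat.hom_ext (ContinuousMap.ext fun K => Hyperspace.ext_hit fun U => ?_)
    refine (Hyperspace.join_mem_hit _ U).trans ?_
    refine (Hyperspace.map_mem_hit ⟨Hyperspace.join, Hyperspace.continuous_join⟩ K _).trans ?_
    rw [Hyperspace.comap_join_hitOpens]
    exact ((Hyperspace.join_mem_hit _ U).trans (Hyperspace.join_mem_hit K _)).symm
  left_unit X := by
    refine TopCat.hom_ext (ContinuousMap.ext fun C => Hyperspace.ext_hit fun U => ?_)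
    exact (Hyperspace.join_mem_hit _ U).trans (Hyperspace.unit_mem_hit C _)
  right_unit X := by
    refine TopCat.hom_ext (ContinuousMap.ext fun C => Hyperspace.ext_hit fun U => ?_)
    refine (Hyperspace.join_mem_hit _ U).trans ?_
    refine (Hyperspace.map_mem_hit ⟨Hyperspace.unit, Hyperspace.continuous_unit⟩ C _).trans ?_
    rw [Hyperspace.comap_unit_hitOpens]
    rfl

/-- The support of a continuous valuation: the complement of the union of all open sets of
valuation zero. -/
def ContinuousValuation.supp {X : Type u} [TopologicalSpace X] (ν : ContinuousValuation X) :
    Hyperspace X :=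
  ⟨((sSup {U : Opens X | ν U = 0} : Opens X) : Set X)ᶜ, (Opens.isOpen _).isClosed_compl⟩

/-! A closed set is determined by the open sets that it meets (`Hyperspace.ext_hit`), so every
equation between points of the hyperspace can be tested on the relation "meets `U`". For the support
this relation is as simple as possible: `ν.supp` meets `U` exactly when `0 < ν U` (`supp_mem_hit`).
The substance is that the union of all null open sets is again null, which is where Scott continuity
enters: null open sets are closed under finite unions by modularity, so they form a directed family
and the supremum of their values is `0`.

On the other side, closures are invisible to open sets: `f_♯ C` meets `U` iff `C` meets `f⁻¹ U`, the
closure of `{x}` meets `U` iff `x ∈ U`, and `𝒰 K` meets `U` iff `K` meets `Hit(U)`. Naturality and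
the unit law then amount to evaluating `f_* ν` and `δ_x` on `U`.

The multiplication needs one further fact, `integral_pos_iff`: the integral of a lower
semicontinuous `g ≥ 0` is positive iff `{g > 0}` has positive valuation. For `g = (ν ↦ ν U)` this
says that `ℰ ξ` charges `U` iff `ξ` charges the open set of those `ν` that charge `U`, and this set
is the preimage of `Hit(U)` under the support map. -/

namespace ContinuousValuation

variable {X Y : Type u} [TopologicalSpace X] [TopologicalSpace Y]

/-! ### The support and the open sets it meets -/

/-- The largest null open set of a continuous valuation is null. -/
lemma map_sSup_null (ν : ContinuousValuation X) : ν (sSup {U : Opens X | ν U = 0}) = 0 := by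
  rw [ν.scott' _ ⟨⊥, ν.map_bot'⟩]
  · simp
  -- The null open sets are directed: by modularity `ν (U ⊔ V) + ν (U ⊓ V) = 0 + 0`, and a sum in
  -- `[0, ∞]` vanishes only if both terms do.
  · intro U hU V hV
    refine ⟨U ⊔ V, ?_, le_sup_left, le_sup_right⟩
    have h := ν.modular' U V
    rw [show ν U = 0 from hU, show ν V = 0 from hV, add_zero] at h
    exact (add_eq_zero.1 h).1

/-- A null `U` is among the sets removed to form the support. Conversely, an open set that misses
the support lies inside the largest null open set, so it is null by monotonicity. All later results
about supports reduce to this criterion. -/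
lemma supp_mem_hit (ν : ContinuousValuation X) (U : Opens X) :
    ν.supp ∈ Hyperspace.hit U ↔ 0 < ν U := by
  rw [pos_iff_ne_zero]
  constructor
  · rintro ⟨x, hx, hU⟩ h
    exact hx (Opens.mem_sSup.2 ⟨U, h, hU⟩)
  · intro h
    by_contra hU
    refine h (le_antisymm (le_trans (ν.map_mono fun x hx => ?_) ν.map_sSup_null.le) zero_le)
    by_contra hx'
    exact hU ⟨x, hx', hx⟩

/-- One direction, read at `C = ν.supp`, is the existence half of the characterisation; the other is
uniqueness, which holds because two closed sets meeting the same open sets coincide. -/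
lemma eq_supp_iff (ν : ContinuousValuation X) (C : Hyperspace X) :
    C = ν.supp ↔ ∀ U : Opens X, ((C : Set X) ∩ (U : Set X)).Nonempty ↔ 0 < ν U := by
  constructor
  · rintro rfl U
    exact ν.supp_mem_hit U
  · exact fun h => Hyperspace.ext_hit fun U => (h U).trans (ν.supp_mem_hit U).symm

/-! ### Continuity, naturality and the unit -/

lemma continuous_supp : Continuous (supp : ContinuousValuation X → Hyperspace X) := by
  refine Hyperspace.continuous_of_hit fun U => ?_
  rw [show supp ⁻¹' Hyperspace.hit U = {ν : ContinuousValuation X | 0 < ν U} from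
    Set.ext fun ν => ν.supp_mem_hit U]
  -- The preimage of a subbasic set is itself subbasic, with threshold `r = 0`.
  exact isOpen_theta U 0

/-- Both sides meet `U` exactly when `ν` is positive on `f⁻¹ U`. -/
lemma supp_map (f : C(X, Y)) (ν : ContinuousValuation X) :
    (ν.map f).supp = ν.supp.map f :=
  Hyperspace.ext_hit fun U => ((ν.map f).supp_mem_hit U).trans
    ((ν.supp_mem_hit (U.comap f)).symm.trans (Hyperspace.map_mem_hit f ν.supp U).symm)

lemma supp_dirac (x : X) : (dirac x).supp = Hyperspace.unit x := by
  refine Hyperspace.ext_hit fun U => ?_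
  rw [supp_mem_hit, Hyperspace.unit_mem_hit]
  by_cases h : x ∈ U <;> simp [dirac, h]

/-! ### Positivity of integrals and the multiplication -/

/-- The integral of a lower semicontinuous function is positive if and only if the function is
positive on an open set of positive valuation. -/
lemma integral_pos_iff (ν : ContinuousValuation X) (g : X → ℝ≥0∞) (hg : LowerSemicontinuous g) :
    0 < ν.integral g ↔ 0 < ν (superlevel g hg 0) := by
  rw [integral_eq ν g hg]
  constructor
  · intro h
    obtain ⟨n, hn⟩ := lt_iSup_iff.1 h
    rw [pos_iff_ne_zero] at hn ⊢
    -- Every superlevel set in the dyadic sum is contained in `{g > 0}`, so if the latter is null,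
    -- all summands vanish.
    refine fun h0 => hn ?_
    rw [Finset.sum_eq_zero, mul_zero]
    intro k _
    refine le_antisymm (le_trans (ν.map_mono fun x hx => ?_) h0.le) zero_le
    exact zero_le.trans_lt (show _ < g x from hx)
  · intro h
    -- Passing to a point `x` of the support with `0 < g x` avoids a limit over thresholds: once
    -- `2⁻¹ ^ n < g x`, the open set `{g > 2⁻¹ ^ n}` contains `x`, hence meets the support and has
    -- positive valuation.
    obtain ⟨x, hx, hgx⟩ := (ν.supp_mem_hit _).2 h
    obtain ⟨n, hn⟩ := ENNReal.exists_inv_two_pow_lt (show 0 < g x from hgx).ne'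
    -- The threshold is `2⁻¹ ^ n`, written as the `k = 0` term of the dyadic sum; that term alone
    -- makes the sum positive.
    have hpos : 0 < ν (superlevel g hg (((0 : ℕ) + 1 : ℝ≥0∞) * 2⁻¹ ^ n)) :=
      (ν.supp_mem_hit _).1 ⟨x, hx, by simpa [superlevel] using hn⟩
    refine lt_iSup_iff.2 ⟨n, ENNReal.mul_pos (two_inv_pow_ne_zero n) ?_⟩
    exact (hpos.trans_le (Finset.single_le_sum
      (f := fun k : ℕ => ν (superlevel g hg (((k : ℝ≥0∞) + 1) * 2⁻¹ ^ n)))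
      (fun _ _ => zero_le) (Finset.mem_range.2 (by positivity)))).ne'

/-- Both sides say that `ξ` is positive on `{ν | 0 < ν U}`: the left because `ℰ ξ (U)` is the
integral of `ν ↦ ν U`, the right because this set is the preimage of `Hit(U)` under `supp`. -/
lemma supp_join_mem_hit (ξ : ContinuousValuation (ContinuousValuation X)) (U : Opens X) :
    ξ.join.supp ∈ Hyperspace.hit U ↔
      ξ.supp ∈ Hyperspace.hit ((Hyperspace.hitOpens U).comap ⟨supp, continuous_supp⟩) := by
  rw [supp_mem_hit, supp_mem_hit,
    show (Hyperspace.hitOpens U).comap ⟨supp, continuous_supp⟩ = superlevel _ (lsc_eval U) 0 from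
      Opens.ext (Set.ext fun ν => ν.supp_mem_hit U)]
  exact ξ.integral_pos_iff _ (lsc_eval U)

lemma supp_join (ξ : ContinuousValuation (ContinuousValuation X)) :
    ξ.join.supp = (ξ.supp.map supp).join := by
  refine Hyperspace.ext_hit fun U => (ξ.supp_join_mem_hit U).trans ?_
  exact ((Hyperspace.join_mem_hit _ U).trans
    (Hyperspace.map_mem_hit ⟨supp, continuous_supp⟩ ξ.supp _)).symm

/-- The closure taken inside `supp_♯` is redundant: an open set meets the union of the supports iff
some `ν` in `ξ.supp` has a support meeting it. -/
lemma supp_join_eq_cl (ξ : ContinuousValuation (ContinuousValuation X)) :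
    ξ.join.supp = Hyperspace.cl (⋃ ν ∈ ξ.supp, (ν.supp : Set X)) := by
  refine Hyperspace.ext_hit fun U => (ξ.supp_join_mem_hit U).trans ?_
  rw [Hyperspace.cl_mem_hit]
  constructor
  · rintro ⟨ν, hν, x, hx, hU⟩
    exact ⟨x, Set.mem_iUnion₂.2 ⟨ν, hν, hx⟩, hU⟩
  · rintro ⟨x, hx, hU⟩
    obtain ⟨ν, hν, hx⟩ := Set.mem_iUnion₂.1 hx
    exact ⟨ν, hν, x, hx, hU⟩

end ContinuousValuation

/-! ### The morphism of monads -/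

/-- The support, as a morphism from the valuation monad to the hyperspace monad. -/
noncomputable def suppMonadHom : MonadHom valuationMonad.{u} hyperspaceMonad.{u} where
  app _ := TopCat.ofHom ⟨ContinuousValuation.supp, ContinuousValuation.continuous_supp⟩
  naturality _ _ f := TopCat.hom_ext (ContinuousMap.ext fun ν =>
    ContinuousValuation.supp_map f.hom ν)
  app_η _ := TopCat.hom_ext (ContinuousMap.ext fun x => ContinuousValuation.supp_dirac x)
  -- `MonadHom` pushes `ξ` forward along `supp` and then takes the support in `V(HX)`, whereas
  -- `supp_join` takes the support of `ξ` first and then its image. The two agree by naturality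
  -- applied to the continuous map `supp` itself.
  app_μ _ := TopCat.hom_ext (ContinuousMap.ext fun ξ => (ContinuousValuation.supp_join ξ).trans
    (congrArg Hyperspace.join (ContinuousValuation.supp_map
      ⟨ContinuousValuation.supp, ContinuousValuation.continuous_supp⟩ ξ).symm))

theorem mainTheorem1 :
    (∀ (X : Type u) [TopologicalSpace X] (ν : ContinuousValuation X) (C : Hyperspace X),
      C = ν.supp ↔ ∀ U : Opens X, ((C : Set X) ∩ (U : Set X)).Nonempty ↔ 0 < ν U) ∧
    (∀ (X : Type u) [TopologicalSpace X],
      Continuous (ContinuousValuation.supp : ContinuousValuation X → Hyperspace X)) ∧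
    (∀ (X Y : Type u) [TopologicalSpace X] [TopologicalSpace Y] (f : C(X, Y))
      (ν : ContinuousValuation X), (ν.map f).supp = ν.supp.map f) ∧
    (∀ (X : Type u) [TopologicalSpace X] (x : X),
      (ContinuousValuation.dirac x).supp = Hyperspace.unit x ∧
      ((ContinuousValuation.dirac x).supp : Set X) = closure {x}) ∧
    (∀ (X : Type u) [TopologicalSpace X] (ξ : ContinuousValuation (ContinuousValuation X)),
      ξ.join.supp = (ξ.supp.map ContinuousValuation.supp).join ∧
      (ξ.join.supp : Set X) = closure (⋃ ν ∈ ξ.supp, (ν.supp : Set X))) ∧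
    ∃ φ : MonadHom valuationMonad.{u} hyperspaceMonad.{u},
      ∀ (X : TopCat.{u}) (ν : ContinuousValuation X), (φ.app X).hom ν = ν.supp := by
  exact ⟨fun _ _ ν C => ν.eq_supp_iff C, fun _ _ => ContinuousValuation.continuous_supp,
    fun _ _ _ _ f ν => ContinuousValuation.supp_map f ν,
    fun _ _ x => ⟨ContinuousValuation.supp_dirac x,
      congrArg SetLike.coe (ContinuousValuation.supp_dirac x)⟩,
    fun _ _ ξ => ⟨ξ.supp_join, congrArg SetLike.coe ξ.supp_join_eq_cl⟩,
    suppMonadHom, fun _ _ => rfl⟩
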